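/- Let $c_i,d_i$ ($i\in\mathbb Z$) be formal variables and, for $\gamma\in\mathbb Z$, put $C^{(\gamma)}(z)=\sum_{i\in\mathbb Z}c_{i+\gamma}z^{-i-1}$ and $D^{(\gamma)}(z)=\sum_{i\in\mathbb Z}d_{i+\gamma}z^{-i-1}$. On three-component fermionic Fock space (semi-infinite wedges of the vectors $e_az^m$, $a=0,1,2$, $m\in\mathbb Z$, with vacuum $v_0=e_0\wedge e_1\wedge e_2\wedge e_0z\wedge e_1z\wedge e_2z\wedge\cdots$ and with the bilinear form for which the elementary wedges are orthonormal), let $e(u)$ and $i(u)$ be the exterior and interior product operators, let $$E_{ab}(w)=\sum_{p,q\in\mathbb Z}e(e_az^p)\,i(e_bz^q)\,w^{q-p-1}\qquad(a\ne b),$$ let $Q_a$ be the fermionic translation operators, lifting the maps $e_az^m\mapsto e_az^{m-1}$, $e_bz^m\mapsto e_bz^m$ ($b\neq a$), and let $T_1=Q_1Q_0^{-1}$, $T_2=Q_2Q_1^{-1}$. For $\alpha,\beta\in\mathbb Z$ and integers $k,\ell\ge0$ define the $\widehat{GL_3}$ tau-function in the case $E^{(\beta)}=0$ by $$\tau_{k,\ell}^{(\alpha,\beta)}=\big\langle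 g^{(\alpha,\beta)}v_0,\;T_1^kT_2^\ell v_0\big\rangle,\qquad g^{(\alpha,\beta)}=\exp\Big(\operatorname{Res}_w\big(C^{(\alpha-\beta)}(w)E_{10}(w)+D^{(\alpha)}(w)E_{20}(w)\big)\Big),$$ a polynomial in the $c_i,d_i$; here $g^{(\alpha,\beta)}$ lifts the loop group element $\begin{pmatrix}1&0&0\\ C^{(\alpha-\beta)}(z)&1&0\\ D^{(\alpha)}(z)&0&1\end{pmatrix}$. Let $S_c^+=S_c^+(z)$ and $S_d^+=S_d^+(z)$ be the multiplicative shift fields: $S_c^+$ sends $c_i\mapsto c_i-c_{i+1}z^{-1}$ and fixes the $d_i$, while $S_d^+$ sends $d_i\mapsto d_i-d_{i+1}z^{-1}$ and fixes the $c_i$. Then $\tau_{k,\ell}^{(\alpha,\beta)}\ne0$ as a polynomial if and only if $\ell\le k$. Moreover, let the $c_i,d_i$ take any values in a field $L\supseteq\mathbb C$ (for instance complex values, or the formal variables themselves in the field of rational functions) for which $\tau_{k,\ell}^{(\alpha,\beta)}\neq0$. Then $$p_{k,\ell}^{(\alpha,\beta)}(z)=\frac{1}{\tau_{k,\ell}^{(\alpha,\beta)}}\,z^kS_c^+S_d^+\tau_{k,\ell}^{(\alpha,\beta)}$$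 (the shift fields being applied before the values are substituted) is a monic polynomial of degree $k$ in $z$, and $$\langle p_{k,\ell}^{(\alpha,\beta)},z^n\rangle_C=0\quad(0\le n<k-\ell),\qquad \langle p_{k,\ell}^{(\alpha,\beta)},z^n\rangle_D=0\quad(0\le n<\ell),$$ where, for polynomials $f,g$, $$\langle f,g\rangle_C=\operatorname{Res}_z\Big(\sum_{i\ge0}\frac{c_{\alpha-\beta+i}}{z^{i+1}}f(z)g(z)\Big),\qquad \langle f,g\rangle_D=\operatorname{Res}_z\Big(\sum_{i\ge0}\frac{d_{\alpha+i}}{z^{i+1}}f(z)g(z)\Big).$$ That is, $p_{k,\ell}^{(\alpha,\beta)}$ is a type II multiple orthogonal polynomial of multi-index $(k-\ell,\ell)$ for these two moment functionals. -/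

import Mathlib

open Polynomial LaurentPolynomial

noncomputable section

namespace FermionGL3

/-! ### Three-component fermionic Fock space -/

/-- The pair `(a, m)` stands for the basis vector `e_a z^m` of `ℂ³ ⊗ ℂ[z, z⁻¹]`. -/
abbrev Idx : Type := Fin 3 × ℤ

/-- The position of `e_a z^m` in the linear order
`… < e₀ < e₁ < e₂ < e₀ z < e₁ z < e₂ z < …` in which the vacuum vector is written. -/
def pos (j : Idx) : ℤ := 3 * j.2 + (j.1 : ℤ)

/-- The basis vectors occurring in the vacuum `e₀ ∧ e₁ ∧ e₂ ∧ e₀ z ∧ e₁ z ∧ e₂ z ∧ ⋯`. -/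
def vacSet : Set Idx := {j | 0 ≤ j.2}

/-- Labels of the elementary wedges. The set `S` labels the semi-infinite wedge of the basis
vectors in `S`, written in increasing order; it is reached from the vacuum by finitely many
exterior and interior products exactly when `S` and `vacSet` differ by a finite set. -/
def Maya : Type := {S : Set Idx // (symmDiff S vacSet).Finite}

/-- The label of the vacuum. -/
def Maya.vac : Maya := ⟨vacSet, by simp⟩

/-- Add the basis vector `j`. -/
def Maya.ins (S : Maya) (j : Idx) : Maya :=
  ⟨insert j S.1, (S.2.union (Set.finite_singleton j)).subset (by
    intro x hx
    simp only [Set.mem_symmDiff, Set.mem_insert_iff, Set.mem_union, Set.mem_singleton_iff] at hx ⊢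
    tauto)⟩

/-- Remove the basis vector `j`. -/
def Maya.del (S : Maya) (j : Idx) : Maya :=
  ⟨S.1 \ {j}, (S.2.union (Set.finite_singleton j)).subset (by
    intro x hx
    simp only [Set.mem_symmDiff, Set.mem_sdiff, Set.mem_union, Set.mem_singleton_iff] at hx ⊢
    tauto)⟩

/-- The ring `ℂ[c_i, d_i : i ∈ ℤ]`. -/
abbrev Coef : Type := MvPolynomial (ℤ ⊕ ℤ) ℂ

/-- The formal variable `c_i`. -/
def cVar (i : ℤ) : Coef := MvPolynomial.X (Sum.inl i)

/-- The formal variable `d_i`. -/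
def dVar (i : ℤ) : Coef := MvPolynomial.X (Sum.inr i)

/-- The (completed) Fock space over `ℂ[c, d]`: formal, possibly infinite, linear combinations
of elementary wedges. `x S` is the coefficient of the wedge `S`. The Fock space itself is the
subspace of finitely supported `x`; exponentials of currents lead into the completion. -/
abbrev Fock : Type := Maya → Coef

open Classical in
/-- The elementary wedge labelled by `S`. -/
def wedge (S : Maya) : Fock := Pi.single S 1

/-- The vacuum vector `v₀`. -/
def v0 : Fock := wedge Maya.vac

/-- The bilinear form for which the elementary wedges are orthonormal, as a pairing of the
completion with the Fock space (one of the arguments has finite support). -/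
def pairing (x y : Fock) : Coef := ∑ᶠ S : Maya, x S * y S

/-- The sign from moving the basis vector `j` to the front past the smaller vectors of `S`. -/
def wedgeSign (j : Idx) (S : Maya) : Coef := (-1) ^ {s ∈ S.1 | pos s < pos j}.ncard

open Classical in
/-- The exterior product operator `e(j) w = j ∧ w`. -/
def extProd (j : Idx) (x : Fock) : Fock := fun S =>
  if j ∈ S.1 then wedgeSign j S * x (S.del j) else 0

open Classical in
/-- The interior product operator: `i(j) (j ∧ w) = w`, and `i(j) w = 0` if `j` is not in `w`. -/
def intProd (j : Idx) (x : Fock) : Fock := fun S =>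
  if j ∈ S.1 then 0 else wedgeSign j S * x (S.ins j)

/-- The operator `Res_w (f(w) E_{ab}(w))` for `a ≠ b`, where `f(w) = ∑ f_i w^{-i-1}` and
`E_{ab}(w) = ψ_a⁺(w) ψ_b⁻(w)`
`= ∑_{p,q} e(e_a z^p) i(e_b z^q) w^{-p-1+q}`. -/
def current (a b : Fin 3) (f : ℤ → Coef) (x : Fock) : Fock := fun S =>
  ∑ᶠ r : ℤ × ℤ, f (r.2 - r.1 - 1) * extProd (a, r.1) (intProd (b, r.2) x) S

/-- The exponential `exp(N) x = ∑ₙ Nⁿ x / n!`, computed coefficient by coefficient. -/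
def expApply (N : Fock → Fock) (x : Fock) : Fock := fun S =>
  ∑ᶠ n : ℕ, ((n.factorial : ℂ)⁻¹) • (N^[n] x) S

/-- `g^{(α,β)} v₀` for `E = 0`. The loop group element has first column
`(1, C^{(α-β)}, D^{(α)})` and is otherwise the identity, where
`C^{(γ)}(z) = ∑ c_{i+γ} z^{-i-1}` and `D^{(γ)}(z) = ∑ d_{i+γ} z^{-i-1}`; so it acts as
`exp(Res_w (C^{(α-β)}(w) E₁₀(w) + D^{(α)}(w) E₂₀(w)))`. -/
def gVac (α β : ℤ) : Fock :=
  expApply (fun x => current 1 0 (fun i => cVar (i + (α - β))) x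
    + current 2 0 (fun i => dVar (i + α)) x) v0

/-! ### Fermionic translation operators -/

/-- `diag(z^{-1} at a, 1 elsewhere)` on basis vectors: `e_a z^m ↦ e_a z^{m-1}`. -/
def shiftIdx (a : Fin 3) : Idx ≃ Idx where
  toFun j := (j.1, if j.1 = a then j.2 - 1 else j.2)
  invFun j := (j.1, if j.1 = a then j.2 + 1 else j.2)
  left_inv j := by rcases j with ⟨b, m⟩; by_cases h : b = a <;> simp [h]
  right_inv j := by rcases j with ⟨b, m⟩; by_cases h : b = a <;> simp [h]

theorem finite_shift_vac (a : Fin 3) :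
    (symmDiff (shiftIdx a '' vacSet) vacSet).Finite := by
  refine (Set.finite_singleton ((a, -1) : Idx)).subset ?_
  rintro ⟨b, m⟩ hx
  have hm : (b, m) ∈ shiftIdx a '' vacSet ↔ (shiftIdx a).symm (b, m) ∈ vacSet := by
    rw [Equiv.image_eq_preimage_symm]; rfl
  rw [Set.mem_symmDiff, hm] at hx
  by_cases h : b = a
  · subst h
    simp only [shiftIdx, vacSet, Equiv.coe_fn_symm_mk, Set.mem_ofPred_eq, if_true] at hx
    simp only [Set.mem_singleton_iff, Prod.mk.injEq, true_and]
    omega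
  · simp only [shiftIdx, vacSet, Equiv.coe_fn_symm_mk, Set.mem_ofPred_eq, if_neg h] at hx
    omega

theorem finite_shift_iff (a : Fin 3) (S : Set Idx) :
    (symmDiff S vacSet).Finite ↔ (symmDiff (shiftIdx a '' S) vacSet).Finite := by
  have key : ∀ A B C : Set Idx, (symmDiff A B).Finite → (symmDiff B C).Finite →
      (symmDiff A C).Finite := fun A B C h1 h2 =>
    (h1.union h2).subset (symmDiff_triangle A B C)
  have himg : (symmDiff S vacSet).Finite ↔
      (symmDiff (shiftIdx a '' S) (shiftIdx a '' vacSet)).Finite := by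
    rw [← Set.image_symmDiff (shiftIdx a).injective,
      Set.finite_image_iff (shiftIdx a).injective.injOn]
  rw [himg]
  refine ⟨fun h => key _ _ _ h (finite_shift_vac a), fun h => key _ _ _ h ?_⟩
  rw [symmDiff_comm]
  exact finite_shift_vac a

/-- The induced bijection of the labels of elementary wedges. -/
def shiftMaya (a : Fin 3) : Maya ≃ Maya :=
  (Equiv.Set.congr (shiftIdx a)).subtypeEquiv (finite_shift_iff a)

/-- The sign from putting the shifted wedge back into increasing order: each `e_a z^m` in `S`
passes the vectors of `S` lying strictly between `e_a z^{m-1}` and `e_a z^m`; for all but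
finitely many `m` an even number of them. -/
def translSign (a : Fin 3) (S : Maya) : Coef :=
  (-1) ^ {m : ℤ | (a, m) ∈ S.1 ∧
    Odd {s ∈ S.1 | pos (a, m - 1) < pos s ∧ pos s < pos (a, m)}.ncard}.ncard

theorem translSign_mul_self (a : Fin 3) (S : Maya) : translSign a S * translSign a S = 1 := by
  rw [translSign, ← mul_pow]; simp

/-- The fermionic translation operator `Q_a`, a lift of `diag(z^{-1} at a, 1 elsewhere)`:
each basis vector in a wedge is replaced by its image, so that `Q_a e(u) = e(u') Q_a` and
`Q_a i(u) = i(u') Q_a` where `u' = e_a z^{m-1}` for `u = e_a z^m` and `u' = u` for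
`u = e_b z^m`, `b ≠ a`. -/
def transl (a : Fin 3) : Fock ≃ₗ[Coef] Fock where
  toFun x S := translSign a ((shiftMaya a).symm S) * x ((shiftMaya a).symm S)
  invFun x S := translSign a S * x (shiftMaya a S)
  map_add' x y := by funext S; simp [mul_add]
  map_smul' r x := by funext S; simp [mul_left_comm]
  left_inv x := by funext S; simp [← mul_assoc, translSign_mul_self]
  right_inv x := by funext S; simp [← mul_assoc, translSign_mul_self]

/-- `T₁ = Q₁ Q₀⁻¹`, a lift of `diag(z, z⁻¹, 1)`. -/
def T1 : Fock ≃ₗ[Coef] Fock := transl 1 * (transl 0)⁻¹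

/-- `T₂ = Q₂ Q₁⁻¹`, a lift of `diag(1, z, z⁻¹)`. -/
def T2 : Fock ≃ₗ[Coef] Fock := transl 2 * (transl 1)⁻¹

/-- The tau-function `τ_{k,ℓ}^{(α,β)} = ⟨g^{(α,β)} v₀, T₁^k T₂^ℓ v₀⟩` for `E = 0`. -/
def tau (α β : ℤ) (k l : ℕ) : Coef := pairing (gVac α β) ((T1 ^ k) ((T2 ^ l) v0))

/-! ### Shift fields and the polynomials -/

/-- `S_c⁺(z)` on `ℂ[c, d]`: the algebra map with `c_i ↦ c_i - c_{i+1} z⁻¹`, `d_i ↦ d_i`. -/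
def shiftC : Coef →ₐ[ℂ] Coef[T;T⁻¹] :=
  MvPolynomial.aeval (Sum.elim
    (fun i => LaurentPolynomial.C (cVar i) - LaurentPolynomial.C (cVar (i + 1)) * T (-1))
    (fun i => LaurentPolynomial.C (dVar i)))

/-- `S_d⁺(z)` on `ℂ[c, d]`: the algebra map with `c_i ↦ c_i`, `d_i ↦ d_i - d_{i+1} z⁻¹`. -/
def shiftD : Coef →ₐ[ℂ] Coef[T;T⁻¹] :=
  MvPolynomial.aeval (Sum.elim
    (fun i => LaurentPolynomial.C (cVar i))
    (fun i => LaurentPolynomial.C (dVar i) - LaurentPolynomial.C (dVar (i + 1)) * T (-1)))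

/-- The unit `z` of the ring of Laurent polynomials. -/
def zUnit : Coef[T;T⁻¹]ˣ where
  val := T 1
  inv := T (-1)
  val_inv := by rw [← T_add]; simp
  inv_val := by rw [← T_add]; simp

/-- Extension of a shift field to Laurent polynomials in `z`, acting on coefficients:
`∑ a_n z^n ↦ ∑ φ(a_n) z^n`. -/
def onCoeffs (φ : Coef →ₐ[ℂ] Coef[T;T⁻¹]) : Coef[T;T⁻¹] →+* Coef[T;T⁻¹] :=
  LaurentPolynomial.eval₂ (φ : Coef →+* Coef[T;T⁻¹]) zUnit

/-- `z^k S_c⁺(z) S_d⁺(z) τ_{k,ℓ}^{(α,β)}`. -/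
def numer (α β : ℤ) (k l : ℕ) : Coef[T;T⁻¹] :=
  T (k : ℤ) * onCoeffs shiftC (shiftD (tau α β k l))

section Specialize

variable {L : Type*} [Field L] [Algebra ℂ L]

/-- Evaluation of the variables `c_i`, `d_i` at elements of a field `L` containing `ℂ`. -/
def specialize (c d : ℤ → L) : Coef →ₐ[ℂ] L := MvPolynomial.aeval (Sum.elim c d)

/-- `p_{k,ℓ}^{(α,β)}(z) = τ⁻¹ z^k S_c⁺(z) S_d⁺(z) τ`, `τ = τ_{k,ℓ}^{(α,β)}`, with the variables
`c_i`, `d_i` evaluated in `L`; a priori a Laurent polynomial in `z`. -/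
def p (c d : ℤ → L) (α β : ℤ) (k l : ℕ) : L[T;T⁻¹] :=
  LaurentPolynomial.C (specialize c d (tau α β k l))⁻¹ *
    AddMonoidAlgebra.mapRingHom ℤ (specialize c d : Coef →+* L) (numer α β k l)

/-- `⟨f, g⟩ = Res_z (∑_{i ≥ 0} m_i z^{-i-1} f(z) g(z))`: the coefficient of `z^{-1}` pairs
`m_i` with the coefficient of `z^i` in `f g`. -/
def momentForm (m : ℕ → L) (f g : L[X]) : L := (f * g).sum fun i a => m i * a

/-- `P` is the type II multiple orthogonal polynomial of multi-index `(n₁, n₂)` for the moment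
functionals with moments `m₁` and `m₂`. -/
structure IsTypeII (m₁ m₂ : ℕ → L) (n₁ n₂ : ℕ) (P : L[X]) : Prop where
  monic : P.Monic
  natDegree_eq : P.natDegree = n₁ + n₂
  orthogonal₁ : ∀ n : ℕ, n < n₁ → momentForm m₁ P (X ^ n) = 0
  orthogonal₂ : ∀ n : ℕ, n < n₂ → momentForm m₂ P (X ^ n) = 0

end Specialize

end FermionGL3

end

noncomputable section

namespace FermionGL3

/-! Up to sign, `τ_{k,ℓ}` is a determinant of moments, and the shift fields turn it into the
classical determinantal formula for multiple orthogonal polynomials.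

The vector `T₁^k T₂^ℓ v₀` is, up to sign, a single wedge. It has lost `e₀ z^q` for `0 ≤ q < k`. When
`ℓ ≤ k` it has gained `e₁ z^{-n-1}` for `n < k - ℓ` and `e₂ z^{-n-1}` for `n < ℓ`. The exponent of
`g` only trades vectors of component 0 for vectors of the other two, so its `n`-th power reaches
only wedges with exactly `n` vacuum vectors removed. By induction with Laplace expansion, the
coefficient of such a wedge is a signed minor (`logG_iterate_apply`, `gVac_apply_of_replaced`).
Hence `τ` is, up to sign, the determinant with rows `c_{α-β+n+q}` and `d_{α+n+q}` (`tau_eq_det`).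
For `ℓ > k` the wedge lacks a vacuum vector of component 1, which `g` cannot remove, so `τ = 0`. For
`ℓ ≤ k` one specialization gives a permutation matrix, so `τ ≠ 0`.

The shift fields replace each entry `m_q` by `m_q - m_{q+1} z⁻¹`. Spreading `z^k` over the rows
yields `det(z m_{i,j} - m_{i,j+1})`, whose coefficient of `z^k` is the moment determinant
(`map_numer`, `coeff_detPoly`). Up to sign this is the moment matrix bordered by the row `1, z, …,
z^k` (`detPoly_eq_bordered`). Pairing with `z^n` turns that row into one of the moment rows, so the
determinant vanishes (`momentForm_detPoly`). -/

/-! ### Positions of the basis vectors -/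

theorem pos_injective : Function.Injective pos := by
  rintro ⟨a, m⟩ ⟨b, n⟩ h
  simp only [pos] at h
  have ha := a.2
  have hb := b.2
  have h1 : (a : ℕ) = b := by omega
  have h2 : a = b := Fin.ext h1
  subst h2
  simp only [Prod.mk.injEq, true_and]
  omega

theorem pos_neg {j : Idx} (h : j.2 < 0) : pos j < 0 := by
  have := j.1.2
  simp only [pos]; omega

theorem pos_nonneg {j : Idx} (h : 0 ≤ j.2) : 0 ≤ pos j := by
  simp only [pos]; omega

/-- Finiteness makes the `ncard` of this set an honest count; an infinite set would have `ncard`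
zero. -/
theorem finite_vac_lt (P : ℤ) : {v : Idx | v ∈ vacSet ∧ pos v < P}.Finite := by
  refine ((Set.finite_Ico (0 : ℤ) P).preimage (f := pos) pos_injective.injOn).subset ?_
  rintro v ⟨h1, h2⟩
  exact ⟨pos_nonneg h1, h2⟩

/-! ### The exponent of `g` -/

/-- The matrix coefficient of `e_j` in `(g - 1) e_r`, for `r` of component `0`. -/
def entry (α β : ℤ) (j r : Idx) : Coef :=
  if j.1 = 1 then cVar (r.2 - j.2 - 1 + (α - β)) else dVar (r.2 - j.2 - 1 + α)

/-- The operator whose exponential is `g^{(α,β)}`. -/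
def logG (α β : ℤ) (x : Fock) : Fock :=
  current 1 0 (fun i => cVar (i + (α - β))) x + current 2 0 (fun i => dVar (i + α)) x

theorem ext_int_apply_ne_zero {j r : Idx} {x : Fock} {S : Maya}
    (h : extProd j (intProd r x) S ≠ 0) :
    j ∈ S.1 ∧ r ∉ (S.del j).1 ∧ x ((S.del j).ins r) ≠ 0 := by
  simp only [extProd, intProd] at h
  split_ifs at h with h1 h2
  · simp at h
  · refine ⟨h1, h2, fun h0 => h ?_⟩
    simp [h0]
  · simp at h

theorem logG_apply_ne_zero {α β : ℤ} {x : Fock} {S : Maya} (h : logG α β x S ≠ 0) :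
    ∃ j r : Idx, j.1 ≠ 0 ∧ r.1 = 0 ∧ extProd j (intProd r x) S ≠ 0 := by
  by_contra! hc
  apply h
  simp only [logG, current, Pi.add_apply]
  rw [finsum_eq_zero_of_forall_eq_zero, finsum_eq_zero_of_forall_eq_zero, add_zero]
  · intro t
    rw [hc (2, t.1) (0, t.2) (by simp) rfl, mul_zero]
  · intro t
    rw [hc (1, t.1) (0, t.2) (by simp) rfl, mul_zero]

/-- The wedges reached from the vacuum by replacing `n` vectors of component `0` by vectors of
the other components. -/
structure Reached (n : ℕ) (S : Maya) : Prop where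
  added : ∀ j ∈ S.1, j ∉ vacSet → j.1 ≠ 0
  removed : ∀ j ∈ vacSet, j ∉ S.1 → j.1 = 0
  card_removed : (vacSet \ S.1).ncard = n

theorem finite_removed (S : Maya) : (vacSet \ S.1).Finite :=
  S.2.subset (by rw [Set.symmDiff_def]; exact Set.subset_union_right)

/-- A vector of component 0 present in a reached wedge must come from the vacuum, and a vector of
another component absent from it must lie outside the vacuum. So every further exchange removes one
new vacuum vector and never undoes an earlier step. -/
theorem reached_of_logG_iterate {α β : ℤ} (n : ℕ) (S : Maya)
    (h : (logG α β)^[n] v0 S ≠ 0) : Reached n S := by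
  classical
  induction n generalizing S with
  | zero =>
    have : S = Maya.vac := by
      by_contra hS
      exact h (by simp [v0, wedge, hS])
    subst this
    exact ⟨fun j h1 h2 => absurd h1 h2, fun j h1 h2 => absurd h1 h2, by simp [Maya.vac]⟩
  | succ n ih =>
    rw [Function.iterate_succ_apply'] at h
    obtain ⟨j, r, hj, hr, hjr⟩ := logG_apply_ne_zero h
    obtain ⟨h1, h2, h3⟩ := ext_int_apply_ne_zero hjr
    obtain ⟨hA, hR, hc⟩ := ih _ h3
    have hne : j ≠ r := fun e => hj (e ▸ hr)
    simp only [Maya.ins, Maya.del, Set.mem_insert_iff, Set.mem_sdiff, Set.mem_singleton_iff]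
      at hA hR hc h2
    have hrS : r ∉ S.1 := fun e => h2 ⟨e, fun e' => hne e'.symm⟩
    have hrv : r ∈ vacSet := by
      by_contra e
      exact hA r (Or.inl rfl) e hr
    have hjv : j ∉ vacSet := by
      intro e
      exact hj (hR j e (by tauto))
    refine ⟨fun i hi hiv => ?_, fun i hi hiS => ?_, ?_⟩
    · by_cases e : i = j
      · exact e ▸ hj
      · exact hA i (by tauto) hiv
    · by_cases e : i = r
      · exact e ▸ hr
      · exact hR i hi (by tauto)
    · have : vacSet \ S.1 = insert r (vacSet \ insert r (S.1 \ {j})) := by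
        ext i
        simp only [Set.mem_insert_iff, Set.mem_sdiff, Set.mem_singleton_iff]
        constructor
        · rintro ⟨a, b⟩
          by_cases e : i = r <;> tauto
        · rintro (rfl | ⟨a, b⟩)
          · exact ⟨hrv, hrS⟩
          · refine ⟨a, fun hi => b (Or.inr ⟨hi, ?_⟩)⟩
            rintro rfl
            exact hjv a
      have hfin : (vacSet \ insert r (S.1 \ {j})).Finite := finite_removed ((S.del j).ins r)
      rw [this, Set.ncard_insert_of_notMem (by simp) hfin, hc]

/-- The wedge `S` arises from the vacuum by replacing the vectors `r j` of component `0` by the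
vectors `a i` of the other components; both families are listed in increasing order. -/
structure Replaced {n : ℕ} (a r : Fin n → Idx) (S : Maya) : Prop where
  comp_added : ∀ i, (a i).1 ≠ 0
  deg_added : ∀ i, (a i).2 < 0
  comp_removed : ∀ j, (r j).1 = 0
  deg_removed : ∀ j, 0 ≤ (r j).2
  mono_added : StrictMono (pos ∘ a)
  mono_removed : StrictMono (pos ∘ r)
  eq : S.1 = (vacSet \ Set.range r) ∪ Set.range a

theorem range_comp_succAbove {X : Type*} {n : ℕ} {a : Fin (n + 1) → X}
    (ha : Function.Injective a) (i : Fin (n + 1)) :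
    Set.range (a ∘ i.succAbove) = Set.range a \ {a i} := by
  rw [Set.range_comp, Fin.range_succAbove, Set.image_compl_eq_range_sdiff_image ha,
    Set.image_singleton]

namespace Replaced

variable {n : ℕ} {a r : Fin n → Idx} {S : Maya}

theorem injective_added (h : Replaced a r S) : Function.Injective a :=
  fun _ _ e => h.mono_added.injective (by simp [e])

theorem injective_removed (h : Replaced a r S) : Function.Injective r :=
  fun _ _ e => h.mono_removed.injective (by simp [e])

theorem added_notMem_vac (h : Replaced a r S) (i : Fin n) : a i ∉ vacSet :=
  fun e => absurd (h.deg_added i) (not_lt.mpr e)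

theorem added_mem (h : Replaced a r S) (i : Fin n) : a i ∈ S.1 := by
  rw [h.eq]; exact Or.inr ⟨i, rfl⟩

theorem removed_ne_added (h : Replaced a r S) (i j : Fin n) : r j ≠ a i :=
  fun e => h.comp_added i (e ▸ h.comp_removed j)

theorem removed_notMem (h : Replaced a r S) (j : Fin n) : r j ∉ S.1 := by
  rw [h.eq]
  rintro (⟨-, e⟩ | ⟨i, e⟩)
  · exact e ⟨j, rfl⟩
  · exact h.removed_ne_added i j e.symm

theorem mem_range_added (h : Replaced a r S) {j : Idx} (h1 : j ∈ S.1) (h2 : j ∉ vacSet) :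
    j ∈ Set.range a := by
  rw [h.eq] at h1
  rcases h1 with h1 | h1
  · exact absurd h1.1 h2
  · exact h1

theorem mem_range_removed (h : Replaced a r S) {j : Idx} (h1 : j ∉ S.1) (h2 : j ∈ vacSet) :
    j ∈ Set.range r := by
  rw [h.eq] at h1
  by_contra e
  exact h1 (Or.inl ⟨h2, e⟩)

theorem ncard_lt_added (h : Replaced a r S) (i : Fin n) :
    {s ∈ S.1 | pos s < pos (a i)}.ncard = i := by
  have : {s ∈ S.1 | pos s < pos (a i)} = a '' (Finset.Iio i : Finset (Fin n)) := by
    ext s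
    simp only [Set.mem_ofPred_eq, Finset.coe_Iio, Set.mem_image, Set.mem_Iio]
    constructor
    · rintro ⟨hs, hlt⟩
      have hv : s ∉ vacSet := fun e => by
        have := pos_nonneg e
        have := pos_neg (h.deg_added i)
        omega
      obtain ⟨i', rfl⟩ := h.mem_range_added hs hv
      exact ⟨i', h.mono_added.lt_iff_lt.mp hlt, rfl⟩
    · rintro ⟨i', hi, rfl⟩
      exact ⟨h.added_mem i', h.mono_added hi⟩
  rw [this, Set.ncard_image_of_injective _ h.injective_added, Set.ncard_coe_finset, Fin.card_Iio]

end Replaced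

namespace Replaced

variable {n : ℕ} {a r : Fin (n + 1) → Idx} {S : Maya}

theorem restore (h : Replaced a r S) (i j : Fin (n + 1)) :
    Replaced (a ∘ i.succAbove) (r ∘ j.succAbove) ((S.del (a i)).ins (r j)) where
  comp_added _ := h.comp_added _
  deg_added _ := h.deg_added _
  comp_removed _ := h.comp_removed _
  deg_removed _ := h.deg_removed _
  mono_added := h.mono_added.comp (Fin.strictMono_succAbove i)
  mono_removed := h.mono_removed.comp (Fin.strictMono_succAbove j)
  eq := by
    rw [range_comp_succAbove h.injective_added, range_comp_succAbove h.injective_removed]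
    simp only [Maya.ins, Maya.del, h.eq]
    ext s
    have h1 : s = a i → s ∉ vacSet := fun e => e ▸ h.added_notMem_vac i
    have h2 : s = r j → s ∈ vacSet := fun e => e ▸ h.deg_removed j
    have h3 : s = r j → s ∉ Set.range a := by
      rintro rfl ⟨i', e⟩
      exact h.removed_ne_added i' j e.symm
    simp only [Set.mem_insert_iff, Set.mem_sdiff, Set.mem_singleton_iff, Set.mem_union]
    tauto

/-- Below `r j` lie the `n` remaining added vectors, all of negative degree, and the vacuum vectors
below `r j` except the `j` removed ones. The count is stated additively to avoid truncated
subtraction. -/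
theorem ncard_lt_removed (h : Replaced a r S) (i j : Fin (n + 1)) :
    {s ∈ (S.del (a i)).1 | pos s < pos (r j)}.ncard + j =
      n + {v : Idx | v ∈ vacSet ∧ pos v < pos (r j)}.ncard := by
  have h1 : {s ∈ (S.del (a i)).1 | pos s < pos (r j)} =
      Set.range (a ∘ i.succAbove) ∪
        ({v : Idx | v ∈ vacSet ∧ pos v < pos (r j)} \ r '' Set.Iio j) := by
    rw [range_comp_succAbove h.injective_added]
    ext s
    simp only [Maya.del, Set.mem_ofPred_eq, Set.mem_sdiff, Set.mem_singleton_iff, Set.mem_union]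
    constructor
    · rintro ⟨⟨hs, hi⟩, hlt⟩
      by_cases hv : s ∈ vacSet
      · refine Or.inr ⟨⟨hv, hlt⟩, ?_⟩
        rintro ⟨j', -, rfl⟩
        exact h.removed_notMem j' hs
      · exact Or.inl ⟨h.mem_range_added hs hv, hi⟩
    · rintro (⟨⟨i', rfl⟩, hi⟩ | ⟨⟨hv, hlt⟩, hj⟩)
      · exact ⟨⟨h.added_mem i', hi⟩,
          (pos_neg (h.deg_added i')).trans_le (pos_nonneg (h.deg_removed j))⟩
      · refine ⟨⟨?_, ?_⟩, hlt⟩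
        · by_contra e
          obtain ⟨j', rfl⟩ := h.mem_range_removed e hv
          exact hj ⟨j', h.mono_removed.lt_iff_lt.mp hlt, rfl⟩
        · rintro rfl
          exact h.added_notMem_vac i hv
  have h2 : r '' Set.Iio j ⊆ {v : Idx | v ∈ vacSet ∧ pos v < pos (r j)} := by
    rintro _ ⟨j', hj, rfl⟩
    exact ⟨h.deg_removed j', h.mono_removed hj⟩
  have h3 : (r '' Set.Iio j).ncard = j := by
    rw [Set.ncard_image_of_injective _ h.injective_removed, ← Finset.coe_Iio,
      Set.ncard_coe_finset, Fin.card_Iio]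
  have h4 := Set.ncard_sdiff_add_ncard_of_subset h2 (finite_vac_lt _)
  have h5 : (Set.range (a ∘ i.succAbove)).ncard = n := by
    rw [← Set.image_univ, Set.ncard_image_of_injective _
      (h.injective_added.comp (Fin.succAbove_right_injective)), Set.ncard_univ, Nat.card_fin]
  rw [h1, Set.ncard_union_eq ?_ (Set.finite_range _) ((finite_vac_lt _).sdiff)]
  · omega
  · rw [Set.disjoint_left]
    rintro _ ⟨i', rfl⟩ ⟨⟨hv, -⟩, -⟩
    exact h.added_notMem_vac _ hv

end Replaced

/-- The sign of the coefficient of a `Replaced` wedge. -/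
def replaceSign {n : ℕ} (r : Fin n → Idx) : Coef :=
  (-1) ^ (∑ i : Fin n, (i : ℕ)) *
    ∏ j : Fin n, (-1) ^ {v : Idx | v ∈ vacSet ∧ pos v < pos (r j)}.ncard

theorem replaceSign_eq_or {n : ℕ} (r : Fin n → Idx) : replaceSign r = 1 ∨ replaceSign r = -1 := by
  rw [replaceSign, Finset.prod_pow_eq_pow_sum, ← pow_add]
  exact neg_one_pow_eq_or _ _

theorem replaceSign_succ {n : ℕ} (r : Fin (n + 1) → Idx) (j : Fin (n + 1)) :
    replaceSign r = (-1) ^ (n + {v : Idx | v ∈ vacSet ∧ pos v < pos (r j)}.ncard) *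
      replaceSign (r ∘ j.succAbove) := by
  rw [replaceSign, replaceSign, Fin.sum_univ_castSucc, Fin.prod_univ_succAbove _ j]
  simp only [Fin.val_castSucc, Fin.val_last, Function.comp_apply, pow_add]
  ring

namespace Replaced

variable {n : ℕ} {a r : Fin (n + 1) → Idx} {S : Maya}

/-- Up to a factor independent of `i`, the two wedge signs combine to the Laplace sign `(-1)^(i+j)`;
in an exponent of `-1`, adding `j` is the same as subtracting it. -/
theorem ext_int_apply (h : Replaced a r S) (x : Fock) (i j : Fin (n + 1)) :
    extProd (a i) (intProd (r j) x) S =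
      (-1) ^ (i + j : ℕ) * (-1) ^ (n + {v : Idx | v ∈ vacSet ∧ pos v < pos (r j)}.ncard) *
        x ((S.del (a i)).ins (r j)) := by
  have h1 : r j ∉ (S.del (a i)).1 := fun e => h.removed_notMem j e.1
  rw [extProd, if_pos (h.added_mem i), intProd, if_neg h1, wedgeSign, wedgeSign,
    h.ncard_lt_added i, ← h.ncard_lt_removed i j, pow_add, pow_add, ← mul_assoc]
  have : ((-1 : Coef) ^ (j : ℕ)) * (-1) ^ (j : ℕ) = 1 := by rw [← mul_pow]; simp
  linear_combination (-(-1 : Coef) ^ (i : ℕ) *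
    (-1) ^ {s ∈ (S.del (a i)).1 | pos s < pos (r j)}.ncard * x ((S.del (a i)).ins (r j))) * this

/-- On a vector supported on wedges with `n` removals, a term contributes only if it creates some `a
i` and annihilates some `r j`. The sum over all pairs of exponents thus has finite support, and
`finsum` does not fall back to its default value. -/
theorem current_apply (h : Replaced a r S) {x : Fock} (hx : ∀ S, x S ≠ 0 → Reached n S)
    {b : Fin 3} (hb : b ≠ 0) (f : ℤ → Coef) :
    current b 0 f x S = ∑ i, ∑ j, if (a i).1 = b then
      f ((r j).2 - (a i).2 - 1) * extProd (a i) (intProd (r j) x) S else 0 := by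
  classical
  set φ : Fin (n + 1) × Fin (n + 1) → ℤ × ℤ := fun t => ((a t.1).2, (r t.2).2) with hφ
  set U : Finset (Fin (n + 1) × Fin (n + 1)) := Finset.univ.filter fun t => (a t.1).1 = b
  have hinj : Set.InjOn φ U := by
    rintro ⟨i, j⟩ hij ⟨i', j'⟩ hij' e
    simp only [U, Finset.coe_filter, Finset.mem_univ, true_and, Set.mem_ofPred_eq] at hij hij'
    simp only [hφ, Prod.mk.injEq] at e
    refine Prod.ext (h.injective_added (Prod.ext (hij.trans hij'.symm) e.1))
      (h.injective_removed (Prod.ext ?_ e.2))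
    rw [h.comp_removed, h.comp_removed]
  rw [current, finsum_eq_sum_of_support_subset (s := U.image φ), Finset.sum_image hinj,
    ← Fintype.sum_prod_type' (f := fun i j => if (a i).1 = b then
        f ((r j).2 - (a i).2 - 1) * extProd (a i) (intProd (r j) x) S else 0)]
  · rw [Finset.sum_filter]
    refine Finset.sum_congr (by simp) fun t _ => ?_
    split_ifs with hb'
    · have e1 : (b, (φ t).1) = a t.1 := Prod.ext hb'.symm rfl
      have e2 : ((0 : Fin 3), (φ t).2) = r t.2 := Prod.ext (h.comp_removed _).symm rfl
      rw [e1, e2]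
    · rfl
  · rintro ⟨p, q⟩ hpq
    have hne := right_ne_zero_of_mul hpq
    obtain ⟨h1, h2, h3⟩ := ext_int_apply_ne_zero hne
    obtain ⟨hA, hR, hc⟩ := hx _ h3
    simp only [Maya.ins, Maya.del, Set.mem_insert_iff, Set.mem_sdiff, Set.mem_singleton_iff]
      at hA hR h2 h1
    have hbp : (b, p) ≠ ((0 : Fin 3), q) := fun e => hb (congrArg Prod.fst e)
    have hq : ((0 : Fin 3), q) ∈ vacSet := by
      by_contra e
      exact hA _ (Or.inl rfl) e rfl
    have hp : (b, p) ∉ vacSet := fun e => hb (hR _ e (by tauto))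
    obtain ⟨i, hi⟩ := h.mem_range_added h1 hp
    obtain ⟨j, hj⟩ := h.mem_range_removed (fun e => h2 ⟨e, hbp.symm⟩) hq
    simp only [Finset.coe_image, Set.mem_image, Finset.mem_coe]
    refine ⟨(i, j), ?_, ?_⟩
    · simp [U, hi]
    · simp [hφ, hi, hj]

theorem logG_apply (h : Replaced a r S) (α β : ℤ) {x : Fock}
    (hx : ∀ S, x S ≠ 0 → Reached n S) :
    logG α β x S = ∑ i, ∑ j, entry α β (a i) (r j) * extProd (a i) (intProd (r j) x) S := by
  rw [logG, Pi.add_apply, h.current_apply hx (by simp), h.current_apply hx (by simp),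
    ← Finset.sum_add_distrib]
  refine Finset.sum_congr rfl fun i _ => ?_
  rw [← Finset.sum_add_distrib]
  refine Finset.sum_congr rfl fun j _ => ?_
  have h0 := h.comp_added i
  have : (a i).1 = 1 ∨ (a i).1 = 2 := by
    revert h0; generalize (a i).1 = t; revert t; decide
  rcases this with e | e <;> simp [entry, e]

end Replaced

/-! ### Coefficients of `g v₀` as minors -/

/-- The exchange performed last can involve any row `i`. For fixed `i`, the sum over `j` is the
Laplace expansion of the full determinant along row `i`; the `n + 1` equal contributions raise `n!`
to `(n + 1)!`. -/
theorem logG_iterate_apply (α β : ℤ) {n : ℕ} {a r : Fin n → Idx} {S : Maya}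
    (h : Replaced a r S) :
    (logG α β)^[n] v0 S = (n.factorial : Coef) * replaceSign r *
      (Matrix.of fun i j => entry α β (a i) (r j)).det := by
  classical
  induction n generalizing S with
  | zero =>
    have : S = Maya.vac := Subtype.ext (by rw [h.eq]; simp [Maya.vac])
    subst this
    simp [v0, wedge, replaceSign]
  | succ n ih =>
    rw [Function.iterate_succ_apply',
      h.logG_apply α β (fun S hS => reached_of_logG_iterate n S hS)]
    have hrow : ∀ i, ∑ j, entry α β (a i) (r j) *
        extProd (a i) (intProd (r j) ((logG α β)^[n] v0)) S =
        (n.factorial : Coef) * replaceSign r *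
          (Matrix.of fun i j => entry α β (a i) (r j)).det := by
      intro i
      rw [Matrix.det_succ_row _ i, Finset.mul_sum]
      refine Finset.sum_congr rfl fun j _ => ?_
      rw [h.ext_int_apply, ih (h.restore i j), replaceSign_succ r j]
      simp only [Matrix.submatrix, Matrix.of_apply, Function.comp_apply]
      ring
    rw [Finset.sum_congr rfl fun i _ => hrow i]
    simp only [Finset.sum_const, Finset.card_univ, Fintype.card_fin, nsmul_eq_mul,
      Nat.factorial_succ, Nat.cast_mul]
    ring

theorem gVac_eq (α β : ℤ) : gVac α β = expApply (logG α β) v0 := rfl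

/-- Only the power of the exponent equal to the number of removed vectors contributes, and its `n!`
cancels the denominator of the exponential. -/
theorem gVac_apply_of_replaced (α β : ℤ) {n : ℕ} {a r : Fin n → Idx} {S : Maya}
    (h : Replaced a r S) :
    gVac α β S = replaceSign r * (Matrix.of fun i j => entry α β (a i) (r j)).det := by
  have hcard : (vacSet \ S.1).ncard = n := by
    have : vacSet \ S.1 = Set.range r := by
      ext s
      constructor
      · rintro ⟨h1, h2⟩
        exact h.mem_range_removed h2 h1
      · rintro ⟨j, rfl⟩
        exact ⟨h.deg_removed j, h.removed_notMem j⟩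
    rw [this, ← Set.image_univ, Set.ncard_image_of_injective _ h.injective_removed,
      Set.ncard_univ, Nat.card_fin]
  rw [gVac_eq, expApply, finsum_eq_single _ n]
  · rw [logG_iterate_apply α β h, mul_assoc, ← nsmul_eq_mul, ← Nat.cast_smul_eq_nsmul ℂ,
      smul_smul, inv_mul_cancel₀ (by exact_mod_cast n.factorial_ne_zero), one_smul]
  · intro m hm
    by_contra hne
    have := (reached_of_logG_iterate m S (fun e => hne (by rw [e, smul_zero]))).card_removed
    exact hm (this.symm.trans hcard)

theorem gVac_apply_ne_zero {α β : ℤ} {S : Maya} (h : gVac α β S ≠ 0) : ∃ n, Reached n S := by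
  by_contra! hc
  rw [gVac_eq] at h
  refine h (finsum_eq_zero_of_forall_eq_zero fun n => ?_)
  by_contra hn
  exact hc n (reached_of_logG_iterate n S (fun e => hn (by rw [e, smul_zero])))

/-! ### Translations of the vacuum -/

/-- The wedge, up to sign, in which the vectors of component `a` are the `e_a z^m`
with `m ≥ n a`. -/
def IsCharged (n : Fin 3 → ℤ) (x : Fock) : Prop :=
  ∃ S : Maya, S.1 = {j | n j.1 ≤ j.2} ∧ (x = wedge S ∨ x = -wedge S)

theorem translSign_eq_or (a : Fin 3) (S : Maya) : translSign a S = 1 ∨ translSign a S = -1 :=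
  neg_one_pow_eq_or _ _

theorem transl_wedge (a : Fin 3) (S : Maya) :
    transl a (wedge S) = translSign a S • wedge (shiftMaya a S) := by
  classical
  funext S'
  change translSign a ((shiftMaya a).symm S') * wedge S ((shiftMaya a).symm S') =
    translSign a S * wedge (shiftMaya a S) S'
  by_cases h : S' = shiftMaya a S
  · subst h
    simp [wedge]
  · have h' : (shiftMaya a).symm S' ≠ S := fun e => h (by rw [← e]; simp)
    simp [wedge, h, h']

theorem shiftMaya_val (a : Fin 3) (S : Maya) : (shiftMaya a S).1 = shiftIdx a '' S.1 := rfl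

theorem IsCharged.transl {n : Fin 3 → ℤ} {x : Fock} (h : IsCharged n x) (a : Fin 3) :
    IsCharged (n - Pi.single a 1) (transl a x) := by
  obtain ⟨S, hS, hx⟩ := h
  refine ⟨shiftMaya a S, ?_, ?_⟩
  · rw [shiftMaya_val, Equiv.image_eq_preimage_symm, hS]
    ext ⟨b, m⟩
    by_cases e : b = a
    · subst e
      simp [shiftIdx]
    · simp [shiftIdx, e]
  · rcases hx with rfl | rfl <;> rcases translSign_eq_or a S with e | e <;>
      simp [transl_wedge, e]

theorem IsCharged.transl_inv {n : Fin 3 → ℤ} {x : Fock} (h : IsCharged n x) (a : Fin 3) :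
    IsCharged (n + Pi.single a 1) ((FermionGL3.transl a)⁻¹ x) := by
  obtain ⟨S, hS, hx⟩ := h
  obtain ⟨S', rfl⟩ := (shiftMaya a).surjective S
  have hinv : (FermionGL3.transl a)⁻¹ (wedge (shiftMaya a S')) =
      translSign a S' • wedge S' := by
    change (FermionGL3.transl a).symm _ = _
    rw [LinearEquiv.symm_apply_eq, map_smul, transl_wedge, smul_smul, translSign_mul_self, one_smul]
  refine ⟨S', ?_, ?_⟩
  · rw [shiftMaya_val, Equiv.image_eq_preimage_symm, Equiv.preimage_eq_iff_eq_image] at hS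
    rw [hS, Equiv.image_eq_preimage_symm]
    ext ⟨b, m⟩
    by_cases e : b = a
    · subst e
      simp [shiftIdx]
    · simp [shiftIdx, e]
  · rcases hx with rfl | rfl <;> rcases translSign_eq_or a S' with e | e <;>
      simp only [map_neg, hinv, e, one_smul, neg_smul, neg_neg] <;> simp

theorem IsCharged.T1_pow {n : Fin 3 → ℤ} {x : Fock} (h : IsCharged n x) (k : ℕ) :
    IsCharged (n + (k : ℤ) • ![1, -1, 0]) ((T1 ^ k) x) := by
  induction k with
  | zero => simpa using h
  | succ k ih =>
    convert (ih.transl_inv 0).transl 1 using 1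
    · funext b
      simp only [Pi.add_apply, Pi.sub_apply, Pi.smul_apply]
      fin_cases b <;> simp <;> ring
    · rw [pow_succ']
      rfl

theorem IsCharged.T2_pow {n : Fin 3 → ℤ} {x : Fock} (h : IsCharged n x) (l : ℕ) :
    IsCharged (n + (l : ℤ) • ![0, 1, -1]) ((T2 ^ l) x) := by
  induction l with
  | zero => simpa using h
  | succ k ih =>
    convert (ih.transl_inv 1).transl 2 using 1
    · funext b
      simp only [Pi.add_apply, Pi.sub_apply, Pi.smul_apply]
      fin_cases b <;> simp <;> ring
    · rw [pow_succ']
      rfl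

theorem isCharged_v0 : IsCharged 0 v0 := ⟨Maya.vac, rfl, Or.inl rfl⟩

theorem isCharged_T1_pow_T2_pow (k l : ℕ) :
    IsCharged ![(k : ℤ), l - k, -l] ((T1 ^ k) ((T2 ^ l) v0)) := by
  convert (isCharged_v0.T2_pow l).T1_pow k using 1
  funext b
  fin_cases b <;> simp
  ring

theorem pairing_wedge (x : Fock) (S : Maya) : pairing x (wedge S) = x S := by
  classical
  rw [pairing, finsum_eq_single _ S]
  · simp [wedge]
  · intro S' h
    simp [wedge, h]

theorem pairing_neg (x y : Fock) : pairing x (-y) = -pairing x y := by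
  simp only [pairing, Pi.neg_apply, mul_neg, finsum_neg_distrib]

/-! ### The tau-function as a determinant of moments -/

/-- The sign left by the translation operators need not be known: it cancels in the quotient
defining `p`. -/
theorem tau_eq_or (α β : ℤ) (k l : ℕ) : ∃ S : Maya,
    S.1 = {j | (![(k : ℤ), l - k, -l] : Fin 3 → ℤ) j.1 ≤ j.2} ∧
      (tau α β k l = gVac α β S ∨ tau α β k l = -gVac α β S) := by
  obtain ⟨S, hS, h⟩ := isCharged_T1_pow_T2_pow k l
  refine ⟨S, hS, ?_⟩
  rw [tau]
  rcases h with h | h <;> rw [h] <;> simp [pairing_wedge, pairing_neg]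

/-- The row of moments belonging to the added vector `j`. -/
def momentRow (α β : ℤ) (j : Idx) (q : ℕ) : Coef := entry α β j (0, (q : ℤ))

theorem tau_eq_zero (α β : ℤ) {k l : ℕ} (h : k < l) : tau α β k l = 0 := by
  obtain ⟨S, hS, hτ⟩ := tau_eq_or α β k l
  have h0 : gVac α β S = 0 := by
    by_contra hne
    obtain ⟨n, hn⟩ := gVac_apply_ne_zero hne
    -- For `k < ℓ` the vacuum vector `e₁` is missing, although only vectors of component 0 can be
    -- removed.
    have := hn.removed (1, 0) (by simp [vacSet]) (by rw [hS]; simp [h])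
    simp at this
  simpa [h0] using hτ

theorem exists_strictMono_pos (A : Finset Idx) {n : ℕ} (h : A.card = n) :
    ∃ a : Fin n → Idx, StrictMono (pos ∘ a) ∧ Set.range a = A := by
  classical
  have hc : (A.image pos).card = n := by rw [Finset.card_image_of_injective _ pos_injective, h]
  have hmem : ∀ i, ∃ j ∈ A, pos j = (A.image pos).orderEmbOfFin hc i := fun i =>
    Finset.mem_image.mp (Finset.orderEmbOfFin_mem _ hc i)
  choose a ha hpos using hmem
  refine ⟨a, fun i j hij => ?_, ?_⟩
  · simpa [hpos] using hij
  · ext j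
    constructor
    · rintro ⟨i, rfl⟩
      exact ha i
    · intro hj
      have : pos j ∈ Set.range ((A.image pos).orderEmbOfFin hc) := by
        rw [Finset.range_orderEmbOfFin]
        exact Finset.mem_coe.mpr (Finset.mem_image_of_mem _ hj)
      obtain ⟨i, hi⟩ := this
      exact ⟨i, pos_injective ((hpos i).trans hi)⟩

/-- The vectors added to the vacuum in `T₁^k T₂^ℓ v₀`, for `k - ℓ = m`. -/
def addedSet (m l : ℕ) : Finset Idx :=
  (Finset.range m).image (fun n : ℕ => ((1 : Fin 3), -(n : ℤ) - 1)) ∪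
    (Finset.range l).image (fun n : ℕ => ((2 : Fin 3), -(n : ℤ) - 1))

theorem card_addedSet (m l : ℕ) : (addedSet m l).card = m + l := by
  rw [addedSet, Finset.card_union_of_disjoint, Finset.card_image_of_injective,
    Finset.card_image_of_injective, Finset.card_range, Finset.card_range]
  · intro a b h; simpa using h
  · intro a b h; simpa using h
  · rw [Finset.disjoint_left]
    simp

theorem tau_eq_det (α β : ℤ) {k l : ℕ} (h : l ≤ k) : ∃ (a : Fin k → Idx) (s : ℂ),
    Function.Injective a ∧ Set.range a = addedSet (k - l) l ∧ s ≠ 0 ∧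
      tau α β k l = MvPolynomial.C s *
        (Matrix.of fun i j : Fin k => momentRow α β (a i) j).det := by
  obtain ⟨a, hmono, hrange⟩ := exists_strictMono_pos (addedSet (k - l) l) (n := k)
    (by rw [card_addedSet]; omega)
  obtain ⟨S, hS, hτ⟩ := tau_eq_or α β k l
  have hmem : ∀ i, a i ∈ addedSet (k - l) l := fun i => by
    rw [← Finset.mem_coe, ← hrange]; exact ⟨i, rfl⟩
  have hR : Replaced a (fun j : Fin k => ((0 : Fin 3), ((j : ℕ) : ℤ))) S := by
    refine ⟨fun i => ?_, fun i => ?_, fun _ => rfl, fun j => by simp, hmono, ?_, ?_⟩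
    · have := hmem i
      simp only [addedSet, Finset.mem_union, Finset.mem_image] at this
      rcases this with ⟨n, -, e⟩ | ⟨n, -, e⟩ <;> simp [← e]
    · have := hmem i
      simp only [addedSet, Finset.mem_union, Finset.mem_image] at this
      rcases this with ⟨n, -, e⟩ | ⟨n, -, e⟩ <;> simp only [← e] <;> omega
    · intro i j hij
      simp only [pos, Function.comp_apply]
      have : (i : ℕ) < j := hij
      omega
    · rw [hS, hrange]
      ext ⟨b, m⟩
      have hr : (b, m) ∈ Set.range (fun j : Fin k => ((0 : Fin 3), ((j : ℕ) : ℤ))) ↔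
          b = 0 ∧ 0 ≤ m ∧ m < k := by
        simp only [Set.mem_range, Prod.mk.injEq]
        constructor
        · rintro ⟨j, rfl, rfl⟩
          exact ⟨rfl, by omega, by have := j.2; omega⟩
        · rintro ⟨rfl, h0, h1⟩
          exact ⟨⟨m.toNat, by omega⟩, rfl, by simp [h0]⟩
      have hA : (b, m) ∈ addedSet (k - l) l ↔
          (b = 1 ∧ m < 0 ∧ (l : ℤ) - k ≤ m) ∨ (b = 2 ∧ m < 0 ∧ -(l : ℤ) ≤ m) := by
        simp only [addedSet, Finset.mem_union, Finset.mem_image, Finset.mem_range, Prod.mk.injEq]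
        constructor
        · rintro (⟨n, hn, rfl, rfl⟩ | ⟨n, hn, rfl, rfl⟩)
          · exact Or.inl ⟨rfl, by omega, by omega⟩
          · exact Or.inr ⟨rfl, by omega, by omega⟩
        · rintro (⟨rfl, h0, h1⟩ | ⟨rfl, h0, h1⟩)
          · exact Or.inl ⟨(-m - 1).toNat, by omega, rfl, by omega⟩
          · exact Or.inr ⟨(-m - 1).toNat, by omega, rfl, by omega⟩
      rw [Set.mem_union, Set.mem_sdiff, hr, Finset.mem_coe, hA]
      fin_cases b <;> simp [vacSet] <;> omega
  have hg := gVac_apply_of_replaced α β hR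
  have hs : ∃ s : ℂ, s ≠ 0 ∧ tau α β k l = MvPolynomial.C s *
      (Matrix.of fun i j : Fin k => momentRow α β (a i) j).det := by
    -- The scalar `s` is the product of the sign of the translated vacuum and `replaceSign`.
    change gVac α β S = _ * (Matrix.of fun i j : Fin k => momentRow α β (a i) j).det at hg
    rcases hτ with hτ | hτ <;>
      rcases replaceSign_eq_or (fun j : Fin k => ((0 : Fin 3), ((j : ℕ) : ℤ))) with e | e <;>
      rw [hτ, hg, e]
    · exact ⟨1, by simp⟩
    · exact ⟨-1, by simp⟩
    · exact ⟨-1, by simp⟩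
    · exact ⟨1, by simp⟩
  obtain ⟨s, hs0, hs⟩ := hs
  exact ⟨a, s, fun _ _ e => hmono.injective (by simp [e]), hrange, hs0, hs⟩

/-! ### Nonvanishing -/

theorem mem_addedSet {m l : ℕ} {j : Idx} (h : j ∈ addedSet m l) :
    (∃ n < m, j = (1, -(n : ℤ) - 1)) ∨ ∃ n < l, j = (2, -(n : ℤ) - 1) := by
  simpa [addedSet, eq_comm] using h

theorem momentRow_one (α β : ℤ) (n q : ℕ) :
    momentRow α β (1, -(n : ℤ) - 1) q = cVar (α - β + ((q + n : ℕ) : ℤ)) := by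
  simp only [momentRow, entry, if_true]
  congr 1; push_cast; ring

theorem momentRow_two (α β : ℤ) (n q : ℕ) :
    momentRow α β (2, -(n : ℤ) - 1) q = dVar (α + ((q + n : ℕ) : ℤ)) := by
  simp only [momentRow, entry]
  rw [if_neg (by decide)]
  congr 1; push_cast; ring

/-- Set `c_{α-β+k-ℓ-1} = d_{α+k-1} = 1` and all other variables to 0. The `c`-rows then have their
single 1 in the columns below `k - ℓ`, the `d`-rows in the remaining columns, each column once. -/
theorem tau_ne_zero (α β : ℤ) {k l : ℕ} (h : l ≤ k) : tau α β k l ≠ 0 := by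
  classical
  obtain ⟨a, s, hinj, hrange, hs, hτ⟩ := tau_eq_det α β h
  have hmem : ∀ i, a i ∈ addedSet (k - l) l := fun i => by
    rw [← Finset.mem_coe, ← hrange]; exact ⟨i, rfl⟩
  -- `f` is the column of the single 1 in row `i`. The second conjunct recovers `a i` from `f`,
  -- which makes the choice of column injective.
  have hf : ∀ i, ∃ f : Fin k, ∀ q : Fin k, specialize (L := ℂ)
      (fun i => if i = α - β + (k - l - 1) then 1 else 0)
      (fun i => if i = α + (k - 1) then 1 else 0) (momentRow α β (a i) q) =
        (if f = q then 1 else 0) ∧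
      a i = if (f : ℕ) < k - l then (1, (f : ℤ) - (k - l)) else (2, (f : ℤ) - k) := by
    intro i
    rcases mem_addedSet (hmem i) with ⟨n, hn, e⟩ | ⟨n, hn, e⟩
    · refine ⟨⟨k - l - 1 - n, by omega⟩, fun q => ⟨?_, ?_⟩⟩
      · rw [e, momentRow_one]
        simp only [specialize, cVar, MvPolynomial.aeval_X, Sum.elim_inl, Fin.ext_iff]
        congr 1
        simp only [eq_iff_iff]
        omega
      · rw [e, if_pos (by simp only; omega)]
        refine Prod.ext rfl ?_
        simp only
        omega
    · refine ⟨⟨k - 1 - n, by omega⟩, fun q => ⟨?_, ?_⟩⟩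
      · rw [e, momentRow_two]
        simp only [specialize, dVar, MvPolynomial.aeval_X, Sum.elim_inr, Fin.ext_iff]
        congr 1
        simp only [eq_iff_iff]
        omega
      · rw [e, if_neg (by simp only; omega)]
        refine Prod.ext rfl ?_
        simp only
        omega
  choose f hf using hf
  have hfinj : Function.Injective f := fun i i' e => hinj <| by
    rw [(hf i (f i)).2, (hf i' (f i)).2, e]
  let σ : Equiv.Perm (Fin k) := Equiv.ofBijective f (Finite.injective_iff_bijective.mp hfinj)
  intro h0
  rw [hτ] at h0
  have h1 := congrArg (specialize (L := ℂ)
      (fun i => if i = α - β + (k - l - 1) then 1 else 0)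
      (fun i => if i = α + (k - 1) then 1 else 0)) h0
  rw [map_mul, AlgHom.map_det, map_zero] at h1
  have h2 : AlgHom.mapMatrix (specialize (L := ℂ)
      (fun i => if i = α - β + (k - l - 1) then 1 else 0)
      (fun i => if i = α + (k - 1) then 1 else 0))
      (Matrix.of fun i j : Fin k => momentRow α β (a i) j) = σ.permMatrix ℂ := by
    ext i j
    simp only [AlgHom.mapMatrix_apply, Matrix.map_apply, Matrix.of_apply, (hf i j).1]
    simp [Equiv.Perm.permMatrix, PEquiv.toMatrix_apply, σ, eq_comm]
  rw [h2, Matrix.det_permutation] at h1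
  rcases mul_eq_zero.mp h1 with h1 | h1
  · simp [specialize] at h1
    exact hs h1
  · rcases Int.units_eq_one_or (Equiv.Perm.sign σ) with e | e <;> simp [e] at h1

/-! ### The determinantal polynomial -/

section Determinant

variable {L : Type*} [Field L]

/-- The polynomial `det (z m_{i,j} - m_{i,j+1})`. -/
def detPoly {k : ℕ} (m : Fin k → ℕ → L) : L[X] :=
  (Matrix.of fun i j : Fin k =>
    X * Polynomial.C (m i j) - Polynomial.C (m i (j + 1))).det

theorem detPoly_eq {k : ℕ} (m : Fin k → ℕ → L) :
    detPoly m = ((X : L[X]) • (Matrix.of fun i j : Fin k => m i j).map Polynomial.C +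
      (Matrix.of fun i j : Fin k => -m i (j + 1)).map Polynomial.C).det := by
  rw [detPoly]
  congr 1
  ext1 i j
  simp [sub_eq_add_neg]

/-- The matrix is a linear pencil `X A + B` of size `k`, which bounds the degree by `k` and makes
`det A` the coefficient of `X^k`. -/
theorem natDegree_detPoly_le {k : ℕ} (m : Fin k → ℕ → L) : (detPoly m).natDegree ≤ k := by
  rw [detPoly_eq]
  simpa using Polynomial.natDegree_det_X_add_C_le (Matrix.of fun i j : Fin k => m i j)
    (Matrix.of fun i j : Fin k => -m i (j + 1))

theorem coeff_detPoly {k : ℕ} (m : Fin k → ℕ → L) :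
    (detPoly m).coeff k = (Matrix.of fun i j : Fin k => m i j).det := by
  rw [detPoly_eq]
  simpa using Polynomial.coeff_det_X_add_C_card (Matrix.of fun i j : Fin k => m i j)
    (Matrix.of fun i j : Fin k => -m i (j + 1))

/-- The matrix of moments with columns `0, …, k`, bordered by the row `t` on top. -/
def bordered {R : Type*} {k : ℕ} (t : ℕ → R) (m : Fin k → ℕ → R) :
    Matrix (Fin (k + 1)) (Fin (k + 1)) R :=
  Matrix.of fun i j => Fin.cases (motive := fun _ => R) (t j) (fun i' => m i' j) i

theorem det_bordered {R : Type*} [CommRing R] {k : ℕ} (t : ℕ → R) (m : Fin k → ℕ → R) :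
    (bordered t m).det = ∑ j : Fin (k + 1), (-1) ^ (j : ℕ) * t j *
      (Matrix.of fun i j' : Fin k => m i (j.succAbove j')).det := by
  rw [Matrix.det_succ_row_zero]
  rfl

theorem detPoly_eq_bordered {k : ℕ} (m : Fin k → ℕ → L) :
    detPoly m = (-1) ^ k * (bordered (fun j => (X : L[X]) ^ j)
      (fun i j => Polynomial.C (m i j))).det := by
  -- Subtracting `X` times the preceding column from every column but the first turns the top row
  -- into `1, 0, …, 0`. The remaining minor is `det(m_{i,j+1} - X m_{i,j})`, which accounts for the
  -- factor `(-1)^k`.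
  rw [Matrix.det_eq_of_forall_col_eq_smul_add_pred (fun _ => (X : L[X]))
    (B := Matrix.of fun i j => Fin.cases (motive := fun _ => L[X])
      (bordered (fun j => (X : L[X]) ^ j) (fun i j => Polynomial.C (m i j)) i 0)
      (fun j' => bordered (fun j => (X : L[X]) ^ j) (fun i j => Polynomial.C (m i j)) i j'.succ -
        X * bordered (fun j => (X : L[X]) ^ j) (fun i j => Polynomial.C (m i j)) i j'.castSucc) j)]
  · rw [Matrix.det_succ_row_zero, Finset.sum_eq_single 0]
    · have : (Matrix.of fun i j : Fin k =>
          X * Polynomial.C (m i j) - Polynomial.C (m i (j + 1))) =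
          (-1 : L[X]) • (Matrix.of fun i j : Fin k =>
            Polynomial.C (m i (j + 1)) - X * Polynomial.C (m i j)) := by
        ext1 i j
        simp
      rw [detPoly, this, Matrix.det_smul]
      simp only [Fintype.card_fin, bordered, Matrix.of_apply, Fin.cases_zero, Fin.val_zero,
        pow_zero, one_mul, mul_one]
      congr 2
    · intro j _ hj
      obtain ⟨j', rfl⟩ := Fin.exists_succ_eq.mpr hj
      simp [bordered, pow_succ']
    · simp
  · intro i; simp
  · intro i j; simp

theorem momentForm_sum (μ : ℕ → L) {k : ℕ} (w : Fin (k + 1) → L) (n : ℕ) :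
    momentForm μ (∑ j, Polynomial.C (w j) * X ^ (j : ℕ)) (X ^ n) = ∑ j : Fin (k + 1), μ (j + n) * w j := by
  have h : ∀ f g : L[X], momentForm μ f g =
      Polynomial.lsum (fun i => LinearMap.mulLeft L (μ i)) (f * g) := fun f g => rfl
  rw [h, Finset.sum_mul, map_sum]
  refine Finset.sum_congr rfl fun j _ => ?_
  rw [mul_assoc, ← pow_add, Polynomial.C_mul_X_pow_eq_monomial, Polynomial.lsum_apply,
    Polynomial.sum_monomial_index _ _ (by simp)]
  rfl

/-- The functional is linear, so it acts on the top row of the bordered matrix only, replacing `X^j`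
by `μ (j + n)`. By `h` this repeats row `i`, and a determinant with two equal rows is zero. -/
theorem momentForm_detPoly {k : ℕ} (m : Fin k → ℕ → L) (μ : ℕ → L) (n : ℕ) (i : Fin k)
    (h : ∀ q, m i q = μ (q + n)) (s : L) :
    momentForm μ (Polynomial.C s * detPoly m) (X ^ n) = 0 := by
  have h1 : Polynomial.C s * detPoly m = ∑ j : Fin (k + 1), Polynomial.C (s * ((-1) ^ k *
      ((-1) ^ (j : ℕ) * (Matrix.of fun i j' : Fin k => m i (j.succAbove j')).det))) *
        X ^ (j : ℕ) := by
    rw [detPoly_eq_bordered, det_bordered, Finset.mul_sum, Finset.mul_sum]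
    refine Finset.sum_congr rfl fun j _ => ?_
    have : (Matrix.of fun i j' : Fin k => Polynomial.C (m i (j.succAbove j'))).det =
        Polynomial.C (Matrix.of fun i j' : Fin k => m i (j.succAbove j')).det := by
      rw [RingHom.map_det]; rfl
    rw [this]
    simp only [map_mul, map_pow, map_neg, map_one]
    ring
  have h2 : (bordered (fun j => μ (j + n)) m).det = 0 := by
    refine Matrix.det_zero_of_row_eq (Fin.succ_ne_zero i) ?_
    funext j
    simp [bordered, h]
  rw [det_bordered] at h2
  rw [h1, momentForm_sum]
  calc _ = s * (-1) ^ k * ∑ j : Fin (k + 1), (-1) ^ (j : ℕ) * μ (j + n) *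
      (Matrix.of fun i j' : Fin k => m i (j.succAbove j')).det := by
        rw [Finset.mul_sum]
        exact Finset.sum_congr rfl fun j _ => by ring
    _ = 0 := by rw [h2, mul_zero]

end Determinant

/-! ### The shift fields -/

theorem onCoeffs_shiftC_shiftD_cVar (i : ℤ) : onCoeffs shiftC (shiftD (cVar i)) =
    LaurentPolynomial.C (cVar i) - LaurentPolynomial.C (cVar (i + 1)) * T (-1) := by
  simp [onCoeffs, shiftD, shiftC, cVar]

theorem onCoeffs_shiftC_shiftD_dVar (i : ℤ) : onCoeffs shiftC (shiftD (dVar i)) =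
    LaurentPolynomial.C (dVar i) - LaurentPolynomial.C (dVar (i + 1)) * T (-1) := by
  simp [onCoeffs, shiftD, shiftC, dVar, zUnit]

theorem onCoeffs_shiftC_shiftD_momentRow (α β : ℤ) (j : Idx) (q : ℕ) :
    onCoeffs shiftC (shiftD (momentRow α β j q)) =
      LaurentPolynomial.C (momentRow α β j q) -
        LaurentPolynomial.C (momentRow α β j (q + 1)) * T (-1) := by
  simp only [momentRow, entry]
  split_ifs
  · rw [onCoeffs_shiftC_shiftD_cVar]
    congr 4; push_cast; ring
  · rw [onCoeffs_shiftC_shiftD_dVar]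
    congr 4; push_cast; ring

theorem onCoeffs_shiftC_shiftD_C (s : ℂ) :
    onCoeffs shiftC (shiftD (MvPolynomial.C s)) = LaurentPolynomial.C (MvPolynomial.C s) := by
  have h : ∀ t : ℂ, algebraMap ℂ Coef[T;T⁻¹] t = LaurentPolynomial.C (MvPolynomial.C t) :=
    fun t => rfl
  rw [onCoeffs, shiftD, MvPolynomial.aeval_C, h, LaurentPolynomial.eval₂_C]
  change shiftC (MvPolynomial.C s) = _
  rw [shiftC, MvPolynomial.aeval_C, h]

variable {L : Type*} [Field L] [Algebra ℂ L]

theorem mapRingHom_C {R S : Type*} [CommRing R] [CommRing S] (f : R →+* S) (x : R) :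
    AddMonoidAlgebra.mapRingHom ℤ f (LaurentPolynomial.C x) = LaurentPolynomial.C (f x) :=
  AddMonoidAlgebra.mapRingHom_single f 0 x

theorem mapRingHom_T {R S : Type*} [CommRing R] [CommRing S] (f : R →+* S) (n : ℤ) :
    AddMonoidAlgebra.mapRingHom ℤ f (T n : R[T;T⁻¹]) = T n := by
  rw [T, AddMonoidAlgebra.mapRingHom_single, map_one]; rfl

theorem map_numer (c d : ℤ → L) (α β : ℤ) {k l : ℕ} (a : Fin k → Idx) (s : ℂ)
    (h : tau α β k l = MvPolynomial.C s *
        (Matrix.of fun i j : Fin k => momentRow α β (a i) j).det) :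
    AddMonoidAlgebra.mapRingHom ℤ (specialize c d : Coef →+* L) (numer α β k l) =
      toLaurent (Polynomial.C (algebraMap ℂ L s) *
        detPoly fun i q => specialize c d (momentRow α β (a i) q)) := by
  set φ : Coef →+* L[T;T⁻¹] := ((AddMonoidAlgebra.mapRingHom ℤ (specialize c d : Coef →+* L)).comp
    (onCoeffs shiftC)).comp (shiftD : Coef →+* Coef[T;T⁻¹]) with hφ
  have h1 : AddMonoidAlgebra.mapRingHom ℤ (specialize c d : Coef →+* L) (numer α β k l) =
      T (k : ℤ) * φ (tau α β k l) := by
    rw [numer, map_mul, mapRingHom_T]; rfl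
  have h2 : ∀ t : ℂ, φ (MvPolynomial.C t) = LaurentPolynomial.C (algebraMap ℂ L t) := by
    intro t
    change AddMonoidAlgebra.mapRingHom ℤ _ (onCoeffs shiftC (shiftD _)) = _
    rw [onCoeffs_shiftC_shiftD_C, mapRingHom_C]
    congr 1
    exact MvPolynomial.aeval_C _ _
  have h3 : ∀ j q, φ (momentRow α β j q) =
      LaurentPolynomial.C (specialize c d (momentRow α β j q)) -
        LaurentPolynomial.C (specialize c d (momentRow α β j (q + 1))) * T (-1) := by
    intro j q
    change AddMonoidAlgebra.mapRingHom ℤ _ (onCoeffs shiftC (shiftD _)) = _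
    rw [onCoeffs_shiftC_shiftD_momentRow, map_sub, map_mul, mapRingHom_C, mapRingHom_C,
      mapRingHom_T]
    rfl
  rw [h1, h, map_mul, h2, map_mul, toLaurent_C, mul_left_comm]
  congr 1
  rw [detPoly, RingHom.map_det, RingHom.map_det]
  -- Each of the `k` rows absorbs one factor `z`, which clears its `z⁻¹`.
  have h4 : (T (k : ℤ) : L[T;T⁻¹]) = T 1 ^ Fintype.card (Fin k) := by
    rw [T_pow, Fintype.card_fin, mul_one]
  rw [h4, ← Matrix.det_smul]
  congr 1
  ext1 i j
  simp only [RingHom.mapMatrix_apply, Matrix.smul_apply, Matrix.map_apply, Matrix.of_apply, h3,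
    map_sub, map_mul, toLaurent_X, toLaurent_C, smul_eq_mul, mul_sub]
  congr 1
  rw [mul_left_comm, ← T_add]
  simp

end FermionGL3

end

/-! ### Assembly of the main theorem -/

theorem mainTheorem5 (α β : ℤ) (k l : ℕ) :
    (FermionGL3.tau α β k l ≠ 0 ↔ l ≤ k) ∧
    ∀ (L : Type*) [Field L] [Algebra ℂ L] (c d : ℤ → L),
      FermionGL3.specialize c d (FermionGL3.tau α β k l) ≠ 0 →
      ∃ P : Polynomial L,
        Polynomial.toLaurent P = FermionGL3.p c d α β k l ∧
        P.Monic ∧ P.natDegree = k ∧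
        (∀ n : ℕ, n + l < k → FermionGL3.momentForm
          (fun i : ℕ => c (α - β + (i : ℤ))) P (Polynomial.X ^ n) = 0) ∧
        (∀ n : ℕ, n < l → FermionGL3.momentForm
          (fun i : ℕ => d (α + (i : ℤ))) P (Polynomial.X ^ n) = 0) ∧
        FermionGL3.IsTypeII (fun i : ℕ => c (α - β + (i : ℤ))) (fun i : ℕ => d (α + (i : ℤ)))
          (k - l) l P := by
  refine ⟨⟨fun h => ?_, FermionGL3.tau_ne_zero α β⟩, ?_⟩
  · by_contra hlk
    exact h (FermionGL3.tau_eq_zero α β (not_le.mp hlk))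
  intro L _ _ c d hτ
  have hlk : l ≤ k := by
    by_contra hlk
    rw [FermionGL3.tau_eq_zero α β (not_le.mp hlk), map_zero] at hτ
    exact hτ rfl
  obtain ⟨a, s, -, hrange, -, hdet⟩ := FermionGL3.tau_eq_det α β hlk
  set m : Fin k → ℕ → L :=
    fun i q => FermionGL3.specialize c d (FermionGL3.momentRow α β (a i) q) with hm
  set t : L := FermionGL3.specialize c d (FermionGL3.tau α β k l) with ht
  have htdet : t = algebraMap ℂ L s * (Matrix.of fun i j : Fin k => m i j).det := by
    rw [ht, hdet, map_mul, AlgHom.map_det]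
    congr 1
    exact MvPolynomial.aeval_C _ _
  -- The scalar `s` also occurs in `t`, so it cancels from the leading coefficient.
  set P : Polynomial L := Polynomial.C (t⁻¹ * algebraMap ℂ L s) * FermionGL3.detPoly m with hP
  have hcoeff : P.coeff k = 1 := by
    rw [hP, Polynomial.coeff_C_mul, FermionGL3.coeff_detPoly, mul_assoc, ← htdet,
      inv_mul_cancel₀ hτ]
  have hdeg : P.natDegree ≤ k :=
    (Polynomial.natDegree_C_mul_le _ _).trans (FermionGL3.natDegree_detPoly_le m)
  have hmonic : P.Monic := Polynomial.monic_of_natDegree_le_of_coeff_eq_one k hdeg hcoeff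
  have hnat : P.natDegree = k :=
    Polynomial.natDegree_eq_of_le_of_coeff_ne_zero hdeg (by rw [hcoeff]; exact one_ne_zero)
  have hC : ∀ n : ℕ, n + l < k → FermionGL3.momentForm
      (fun i : ℕ => c (α - β + (i : ℤ))) P (Polynomial.X ^ n) = 0 := by
    intro n hn
    -- Orthogonality to `z^n` comes from the row of the added vector `e₁ z^{-n-1}`, whose entries
    -- are the moments `c_{α-β+q+n}`; this vector is present exactly when `n < k - ℓ`.
    have hmem : ((1 : Fin 3), -(n : ℤ) - 1) ∈ Set.range a := by
      rw [hrange]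
      simp only [FermionGL3.addedSet, Finset.coe_union, Finset.coe_image, Set.mem_union]
      exact Or.inl ⟨n, by simp; omega, rfl⟩
    obtain ⟨i, hi⟩ := hmem
    refine FermionGL3.momentForm_detPoly m _ n i (fun q => ?_) _
    rw [hm]
    simp only
    rw [hi, FermionGL3.momentRow_one]
    exact MvPolynomial.aeval_X _ _
  have hD : ∀ n : ℕ, n < l → FermionGL3.momentForm
      (fun i : ℕ => d (α + (i : ℤ))) P (Polynomial.X ^ n) = 0 := by
    intro n hn
    have hmem : ((2 : Fin 3), -(n : ℤ) - 1) ∈ Set.range a := by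
      rw [hrange]
      simp only [FermionGL3.addedSet, Finset.coe_union, Finset.coe_image, Set.mem_union]
      exact Or.inr ⟨n, by simpa using hn, rfl⟩
    obtain ⟨i, hi⟩ := hmem
    refine FermionGL3.momentForm_detPoly m _ n i (fun q => ?_) _
    rw [hm]
    simp only
    rw [hi, FermionGL3.momentRow_two]
    exact MvPolynomial.aeval_X _ _
  refine ⟨P, ?_, hmonic, hnat, hC, hD, hmonic, by rw [hnat]; omega,
    fun n hn => hC n (by omega), hD⟩
  rw [FermionGL3.p, FermionGL3.map_numer c d α β a s hdet, hP, Polynomial.C_mul, mul_assoc,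
    map_mul, Polynomial.toLaurent_C]
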